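/- Let $0<q<1$. For $x\in\mathbb{Z}^3$ put $l(x)=x^1+x^2+x^3$. Let $\Sigma^\infty$ be the infinite stick $\dots,-e_2-e_3,\,-e_3,\,0,\,e_1,\,e_1+e_2,\,e_1+e_2+e_3,\,e_1+e_2+e_3+e_1,\dots$ in $\mathbb{Z}^3$. A *cylindrical volume* with base $\Gamma$ and length $L+1$ ($L\ge 0$ an even integer, $\Gamma$ a finite subset of the plane $\{l(x)=0\}$ of $\mathbb{Z}^3$) is $\Lambda=\{x+y : x\in\Gamma,\ y\in\Sigma^\infty,\ -L/2\le l(y)\le L/2\}$. For finite $\Lambda\subset\mathbb{Z}^3$ consider $\mathcal H_\Lambda=(\mathbb{C}^2)^{\otimes\Lambda}$ with its orthonormal basis $|\alpha\rangle$, $\alpha\in\{0,1\}^\Lambda$, where $0$ stands for $|{\uparrow}\rangle$ and $1$ for $|{\downarrow}\rangle$ (a particle). Let $\mathsf N|\alpha\rangle=\big(\sum_x\alpha(x)\big)|\alpha\rangle$ and $J^{(3)}=\sum_x S^{(3)}_x$, where $S^{(3)}=\mathrm{diag}(1/2,-1/2)$. Define the canonical and grand canonical ground state vectors (of the spin-$\frac12$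 XXZ ferromagnet with anisotropy $\Delta=\frac12(q+q^{-1})$ and 111 interface boundary terms) $$\psi_0(\Lambda,n)=\sum_{\alpha:\ \sum_x\alpha(x)=n}\ \prod_{x\in\Lambda}q^{l(x)\alpha(x)}\,|\alpha\rangle,\qquad \psi^{GC}(\Lambda,\mu)=\bigotimes_{x\in\Lambda}\big(|{\uparrow}\rangle+q^{l(x)-\mu}|{\downarrow}\rangle\big),$$ and let $\langle X\rangle_{\Lambda,n}$ and $\langle X\rangle^{GC}_{\Lambda,\mu}$ be the expectations $\langle\psi,X\psi\rangle/\langle\psi,\psi\rangle$ in these vectors. A local observable is an operator $X$ on $\mathcal H_{\Lambda_0}$ for some finite $\Lambda_0\subset\mathbb{Z}^3$, identified with $X\otimes 1$ on $\mathcal H_\Lambda$ for $\Lambda\supset\Lambda_0$; it is gauge invariant if it commutes with $J^{(3)}$. Let $\langle X\rangle^{GC}_{\mathbb{Z}^3,\mu}=\langle v,Xv\rangle$, where $v$ is the product $\bigotimes_x \big(|{\uparrow}\rangle+q^{l(x)-\mu}|{\downarrow}\rangle\big)/\sqrt{1+q^{2(l(x)-\mu)}}$ (for $X$ on $\mathcal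 H_{\Lambda_0}$ only the factors with $x\in\Lambda_0$ matter). (i) Let $\Lambda_k$ be cylindrical volumes with bases $\Gamma_k$ and lengths $L_k+1$, such that $\Lambda_k\nearrow\mathbb{Z}^3$ (the $\Lambda_k$ are increasing with union $\mathbb{Z}^3$) and the length does not grow faster than the linear size of the base: $L_k=O(\operatorname{diam}\Gamma_k)$ as $k\to\infty$ (in particular this holds if $L_k=O(|\Gamma_k|^{1/2})$). Let $n_k$ be non-negative integers and $\mu_k\in\mathbb{R}$ with $\langle\mathsf N\rangle^{GC}_{\Lambda_k,\mu_k}=n_k$. If $\mu_k\to\mu\in\mathbb{R}$, then for every gauge invariant local observable $X$ $$\langle X\rangle_{\Lambda_k,n_k}\longrightarrow\langle X\rangle^{GC}_{\mathbb{Z}^3,\mu}\qquad(k\to\infty).$$ (ii) Conversely, for every $\mu\in\mathbb{R}$ there are cylindrical volumes $\Lambda_k$, integers $n_k\ge 0$ and $\mu_k\in\mathbb{R}$ satisfying all the hypotheses of (i), with moreover $L_k=O(|\Gamma_k|^{1/2})$, so that $\langle X\rangle_{\Lambda_k,n_k}\to\langle X\rangle^{GC}_{\mathbb{Z}^3,\mu}$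 for every gauge invariant local observable $X$. -/

import Mathlib

open Filter Topology Asymptotics

namespace XXZ

/-! ### Lattice and cylindrical volumes -/

/-- Sites of the lattice `ℤ³`. -/
abbrev Site : Type := Fin 3 → ℤ

/-- The height `l(x) = x¹ + x² + x³` of a site along the `111` axis. -/
def height (x : Site) : ℤ := x 0 + x 1 + x 2

/-- The `j`-th vertex of the infinite stick
`…, -e₂-e₃, -e₃, 0, e₁, e₁+e₂, e₁+e₂+e₃, e₁+e₂+e₃+e₁, …` (with `0` at `j = 0`).
Integer division rounds down here. -/
def stickPoint (j : ℤ) : Site := ![(j + 2) / 3, (j + 1) / 3, j / 3]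

theorem stickPoint_zero : stickPoint 0 = 0 := by
  funext i; fin_cases i <;> simp [stickPoint]

/-- Consecutive vertices differ by `e₁, e₂, e₃, e₁, …` cyclically. -/
theorem stickPoint_succ (j : ℤ) :
    stickPoint (j + 1) = stickPoint j +
      (if j % 3 = 0 then Pi.single 0 1 else if j % 3 = 1 then Pi.single 1 1
        else Pi.single 2 1) := by
  funext i
  fin_cases i <;> split_ifs <;> simp [stickPoint] <;> omega

theorem height_stickPoint (j : ℤ) : height (stickPoint j) = j := by
  simp [height, stickPoint]; omega

/-- The finite stick of length `L + 1` (`L` even): the vertices of the infinite stick with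
`-L/2 ≤ l(x) ≤ L/2`. -/
noncomputable def stick (L : ℕ) : Finset Site :=
  (Finset.Icc (-((L : ℤ) / 2)) ((L : ℤ) / 2)).image stickPoint

/-- The data of a cylindrical volume: a finite base `Γ` in the plane `l(x) = 0` and an even
integer `L ≥ 0`. -/
structure Cylinder where
  base : Finset Site
  base_height : ∀ x ∈ base, height x = 0
  len : ℕ
  len_even : Even len

/-- The cylindrical volume `Λ = {x + y | x ∈ Γ, y ∈ Σ₀}`. -/
noncomputable def Cylinder.volume (C : Cylinder) : Finset Site :=
  Finset.image₂ (fun x y => x + y) C.base (stick C.len)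

/-- `Λ_k ↗ ℤ³`: the volumes increase and their union is everything. -/
def Exhausts (Λ : ℕ → Finset Site) : Prop :=
  Monotone Λ ∧ ∀ x : Site, ∃ k, x ∈ Λ k

/-! ### Hilbert space, vectors and observables

The Hilbert space `(ℂ²)^{⊗ Λ}` is written in its orthonormal product basis `|α⟩`, indexed by the
configurations `α : Λ → {0, 1}`, with `0` for spin up and `1` for spin down (a particle): vectors
are functions `Config Λ → ℂ` and operators are matrices indexed by `Config Λ`. -/

/-- Particle configurations in the finite volume `Λ`. -/
abbrev Config (Λ : Finset Site) : Type := Λ → Fin 2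

/-- Vectors of `(ℂ²)^{⊗ Λ}`. -/
abbrev Vec (Λ : Finset Site) : Type := Config Λ → ℂ

/-- The algebra of observables of the finite volume `Λ`. -/
abbrev Obs (Λ : Finset Site) : Type := Matrix (Config Λ) (Config Λ) ℂ

/-- The number of particles (down spins) of a configuration. -/
def particles {Λ : Finset Site} (α : Config Λ) : ℕ := ∑ x, (α x : ℕ)

/-- The number operator `N |α⟩ = (∑ₓ α(x)) |α⟩`. -/
def numberOp (Λ : Finset Site) : Obs Λ := Matrix.diagonal fun α => (particles α : ℂ)

/-- The third spin component `Sₓ⁽³⁾`: `1/2` on spin up, `-1/2` on spin down, at the site `x`. -/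
noncomputable def spinZ {Λ : Finset Site} (x : Λ) : Obs Λ :=
  Matrix.diagonal fun α => if α x = 0 then (1 / 2 : ℂ) else -(1 / 2)

/-- The third component `J⁽³⁾ = ∑ₓ Sₓ⁽³⁾` of the total spin. -/
noncomputable def totalSpinZ (Λ : Finset Site) : Obs Λ := ∑ x : Λ, spinZ x

/-- The expectation `⟨ψ, X ψ⟩ / ⟨ψ, ψ⟩`. -/
noncomputable def expval {Λ : Finset Site} (ψ : Vec Λ) (X : Obs Λ) : ℂ :=
  (star ψ ⬝ᵥ X.mulVec ψ) / (star ψ ⬝ᵥ ψ)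

/-- The observable `X ⊗ 1` of `Λ`, for an observable `X` of the subvolume `Λ₀`. -/
def embed {Λ₀ Λ : Finset Site} (h : Λ₀ ⊆ Λ) (X : Obs Λ₀) : Obs Λ := fun α β =>
  if ∀ x : Λ, x.1 ∉ Λ₀ → α x = β x then
    X (fun x => α ⟨x.1, h x.2⟩) (fun x => β ⟨x.1, h x.2⟩)
  else 0

/-- The canonical ground state vector with `n` particles,
`ψ₀(Λ, n) = ∑_{α : N(α) = n} ⨂ₓ q^{l(x) α(x)} |α(x)⟩`. -/
noncomputable def canonicalVec (q : ℝ) (Λ : Finset Site) (n : ℕ) : Vec Λ := fun α =>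
  if particles α = n then ∏ x : Λ, ((q : ℂ) ^ (height x.1 * ((α x : ℕ) : ℤ))) else 0

/-- The grand canonical vector `ψ^{GC}(Λ, μ) = ⨂ₓ (|↑⟩ + q^{l(x) - μ} |↓⟩)`. -/
noncomputable def grandCanonicalVec (q : ℝ) (Λ : Finset Site) (μ : ℝ) : Vec Λ := fun α =>
  ∏ x : Λ, if α x = 0 then (1 : ℂ) else ((q ^ ((height x.1 : ℝ) - μ) : ℝ) : ℂ)

/-- The canonical expectation `⟨X⟩_{Λ, n}` of an observable `X` localized in `Λ₀ ⊆ Λ`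
(and `0` if `Λ₀` is not contained in `Λ`). -/
noncomputable def canonicalAvg (q : ℝ) (Λ : Finset Site) (n : ℕ) {Λ₀ : Finset Site}
    (X : Obs Λ₀) : ℂ :=
  if h : Λ₀ ⊆ Λ then expval (canonicalVec q Λ n) (embed h X) else 0

/-- The expected number of particles `⟨N⟩^{GC}_{Λ, μ}`. -/
noncomputable def grandCanonicalNumber (q : ℝ) (Λ : Finset Site) (μ : ℝ) : ℂ :=
  expval (grandCanonicalVec q Λ μ) (numberOp Λ)

/-- The restriction to `Λ₀` of the infinite product of unit vectors
`⨂ₓ (|↑⟩ + q^{l(x) - μ} |↓⟩) / √(1 + q^{2 (l(x) - μ)})`. -/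
noncomputable def productVec (q : ℝ) (Λ₀ : Finset Site) (μ : ℝ) : Vec Λ₀ := fun α =>
  ∏ x : Λ₀, (if α x = 0 then (1 : ℂ) else ((q ^ ((height x.1 : ℝ) - μ) : ℝ) : ℂ)) /
    ((√(1 + q ^ (2 * ((height x.1 : ℝ) - μ))) : ℝ) : ℂ)

/-- The infinite volume grand canonical product state `⟨X⟩^{GC}_{ℤ³, μ}` on observables `X`
localized in `Λ₀`; the factors at sites outside `Λ₀` are unit vectors and contribute `1`. -/
noncomputable def grandCanonicalAvg (q : ℝ) (μ : ℝ) {Λ₀ : Finset Site} (X : Obs Λ₀) : ℂ :=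
  star (productVec q Λ₀ μ) ⬝ᵥ X.mulVec (productVec q Λ₀ μ)

end XXZ

namespace XXZ

/-! ### Splitting configurations -/

/-! For every `μ`, the canonical vector is a multiple of the `n`-particle component of the grand
canonical product vector. Hence the canonical average of a gauge invariant `X` on `Λ₀` is a quotient
of finite sums over configurations of `Λ₀`, weighted by the probabilities `P(n - i)` that `n - i`
particles sit in `Λ \ Λ₀` under independent occupation (`sectorVec_dotProduct`). It suffices that
`P(n - i) / P(n) → 1` for each fixed `i`.

This flatness needs no local limit theorem. The law `P` is log-concave, so a ratio `P(n + 1) / P(n)`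
away from `1` forces geometric decay on one side of `n`. As `n` is within `|Λ₀|` of the mean, the
mean absolute deviation is then bounded (`tail_le`), and a fourth moment estimate turns this into a
bound on the variance (`sqrt_vari_le`). But the variance diverges, because the plane `l = 0`
supplies infinitely many sites with the same nondegenerate occupation law (`tendsto_vari`).

For the converse, boxes serve as volumes, and the intermediate value theorem tunes `μ_k` so that the
mean is an integer. -/

/-- The configuration on `Λ` made of a configuration on `Λ₀` and one on the rest of `Λ`. -/
def glue {Λ₀ Λ : Finset Site} (σ : Config Λ₀) (η : Config (Λ \ Λ₀)) : Config Λ := fun x =>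
  if hx : x.1 ∈ Λ₀ then σ ⟨x.1, hx⟩ else η ⟨x.1, Finset.mem_sdiff.2 ⟨x.2, hx⟩⟩

/-- Configurations on `Λ` are pairs of configurations on `Λ₀ ⊆ Λ` and on the rest. -/
def splitEquiv {Λ₀ Λ : Finset Site} (h : Λ₀ ⊆ Λ) :
    Config Λ₀ × Config (Λ \ Λ₀) ≃ Config Λ where
  toFun a := glue a.1 a.2
  invFun α := (fun x => α ⟨x.1, h x.2⟩, fun x => α ⟨x.1, (Finset.mem_sdiff.1 x.2).1⟩)
  left_inv a := by
    ext x
    · simp [glue]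
    · have hx := (Finset.mem_sdiff.1 x.2).2
      simp [glue, hx]
  right_inv α := by
    funext x
    by_cases hx : x.1 ∈ Λ₀ <;> simp [glue, hx]

/-- Common source of the factorization of weights and amplitudes and of the additivity of the
particle number. -/
theorem prod_glue {M : Type*} [CommMonoid M] {Λ₀ Λ : Finset Site} (h : Λ₀ ⊆ Λ)
    (f : Site → Fin 2 → M) (σ : Config Λ₀) (η : Config (Λ \ Λ₀)) :
    ∏ x : Λ, f x.1 (glue σ η x) = (∏ x, f x.1 (σ x)) * ∏ x, f x.1 (η x) := by
  classical
  set g : Site → M := fun x => if hx : x ∈ Λ then f x (glue σ η ⟨x, hx⟩) else 1 with hg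
  have h1 : ∏ x : Λ, f x.1 (glue σ η x) = ∏ x ∈ Λ, g x := by
    rw [← Finset.prod_coe_sort Λ g]
    exact Finset.prod_congr rfl fun x _ => by simp [hg]
  have h2 : ∏ x, f x.1 (σ x) = ∏ x ∈ Λ₀, g x := by
    rw [← Finset.prod_coe_sort Λ₀ g]
    exact Finset.prod_congr rfl fun x _ => by simp [hg, h x.2, glue]
  have h3 : ∏ x, f x.1 (η x) = ∏ x ∈ Λ \ Λ₀, g x := by
    rw [← Finset.prod_coe_sort (Λ \ Λ₀) g]
    refine Finset.prod_congr rfl fun x _ => ?_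
    have hx := Finset.mem_sdiff.1 x.2
    simp [hg, hx.1, hx.2, glue]
  rw [h1, h2, h3, mul_comm, Finset.prod_sdiff h]

theorem particles_glue {Λ₀ Λ : Finset Site} (h : Λ₀ ⊆ Λ)
    (σ : Config Λ₀) (η : Config (Λ \ Λ₀)) :
    particles (glue σ η : Config Λ) = particles σ + particles η := by
  have := prod_glue h (fun _ i => Multiplicative.ofAdd (i : ℕ)) σ η
  simp only [← ofAdd_sum, ← ofAdd_add] at this
  exact Multiplicative.ofAdd.injective this

/-! ### Number of particles under independent occupation -/

/-- The probability of `α` when the sites are occupied independently with probabilities `p`. -/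
def weight (p : Site → ℝ) {Λ : Finset Site} (α : Config Λ) : ℝ :=
  ∏ x : Λ, if α x = 0 then 1 - p x.1 else p x.1

/-- The expectation of a function of the number of particles. -/
def countExp (p : Site → ℝ) (Λ : Finset Site) (F : ℤ → ℝ) : ℝ :=
  ∑ α : Config Λ, weight p α * F (particles α)

/-- The probability of finding `n` particles. -/
def countProb (p : Site → ℝ) (Λ : Finset Site) (n : ℤ) : ℝ :=
  countExp p Λ fun j => if j = n then 1 else 0

/-- Independence of the occupations inside and outside `Λ₀`. -/
theorem countExp_split (p : Site → ℝ) {Λ₀ Λ : Finset Site} (h : Λ₀ ⊆ Λ) (F : ℤ → ℝ) :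
    countExp p Λ F =
      countExp p Λ₀ fun i => countExp p (Λ \ Λ₀) fun j => F (i + j) := by
  simp only [countExp]
  rw [← (splitEquiv h).sum_comp, Fintype.sum_prod_type]
  refine Finset.sum_congr rfl fun σ _ => ?_
  rw [Finset.mul_sum]
  refine Finset.sum_congr rfl fun η _ => ?_
  have h1 : weight p (glue σ η : Config Λ) = weight p σ * weight p η :=
    prod_glue h (fun x i => if i = 0 then 1 - p x else p x) σ η
  simp only [splitEquiv, Equiv.coe_fn_mk, h1, particles_glue h]
  push_cast
  ring

theorem countExp_empty (p : Site → ℝ) (F : ℤ → ℝ) : countExp p ∅ F = F 0 := by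
  simp [countExp, weight, particles]

theorem countExp_singleton (p : Site → ℝ) (x : Site) (F : ℤ → ℝ) :
    countExp p {x} F = (1 - p x) * F 0 + p x * F 1 := by
  rw [countExp, ← (Equiv.funUnique ({x} : Finset Site) (Fin 2)).symm.sum_comp]
  simp [weight, particles]

/-- Conditioning on the site `x`; this recursion drives the inductions on the volume below. -/
theorem countExp_insert (p : Site → ℝ) {x : Site} {s : Finset Site} (hx : x ∉ s) (F : ℤ → ℝ) :
    countExp p (insert x s) F =
      (1 - p x) * countExp p s F + p x * countExp p s fun j => F (j + 1) := by
  have h : ({x} : Finset Site) ⊆ insert x s := by simp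
  have h2 : insert x s \ {x} = s := by
    rw [Finset.sdiff_singleton_eq_erase, Finset.erase_insert hx]
  rw [countExp_split p h, countExp_singleton, h2]
  simp [add_comm]

theorem countExp_add (p : Site → ℝ) (s : Finset Site) (F G : ℤ → ℝ) :
    countExp p s (fun j => F j + G j) = countExp p s F + countExp p s G := by
  simp [countExp, mul_add, Finset.sum_add_distrib]

theorem countExp_const_mul (p : Site → ℝ) (s : Finset Site) (c : ℝ) (F : ℤ → ℝ) :
    countExp p s (fun j => c * F j) = c * countExp p s F := by
  simp only [countExp, Finset.mul_sum]
  exact Finset.sum_congr rfl fun _ _ => by ring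

theorem countExp_one (p : Site → ℝ) (s : Finset Site) : countExp p s (fun _ => 1) = 1 := by
  induction s using Finset.induction_on with
  | empty => rw [countExp_empty]
  | insert x s hx ih => rw [countExp_insert p hx, ih]; ring

theorem countExp_const (p : Site → ℝ) (s : Finset Site) (c : ℝ) :
    countExp p s (fun _ => c) = c := by
  simpa [countExp_one] using countExp_const_mul p s c fun _ => 1

theorem weight_nonneg {p : Site → ℝ} (h0 : ∀ x, 0 < p x) (h1 : ∀ x, p x < 1) {s : Finset Site}
    (α : Config s) : 0 ≤ weight p α := by
  refine Finset.prod_nonneg fun x _ => ?_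
  split_ifs
  · linarith [h1 x]
  · exact (h0 x).le

theorem countExp_mono {p : Site → ℝ} (h0 : ∀ x, 0 < p x) (h1 : ∀ x, p x < 1) (s : Finset Site)
    {F G : ℤ → ℝ} (h : ∀ j, F j ≤ G j) : countExp p s F ≤ countExp p s G :=
  Finset.sum_le_sum fun α _ => mul_le_mul_of_nonneg_left (h _) (weight_nonneg h0 h1 α)

theorem countProb_empty (p : Site → ℝ) (n : ℤ) :
    countProb p ∅ n = if n = 0 then 1 else 0 := by
  simp [countProb, countExp_empty, eq_comm]

theorem countProb_insert (p : Site → ℝ) {x : Site} {s : Finset Site} (hx : x ∉ s) (n : ℤ) :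
    countProb p (insert x s) n = (1 - p x) * countProb p s n + p x * countProb p s (n - 1) := by
  simp only [countProb]
  rw [countExp_insert p hx]
  simp only [eq_sub_iff_add_eq]

theorem countProb_nonneg {p : Site → ℝ} (h0 : ∀ x, 0 < p x) (h1 : ∀ x, p x < 1)
    (s : Finset Site) (n : ℤ) : 0 ≤ countProb p s n := by
  have := countExp_mono h0 h1 s (F := fun _ => 0) (G := fun j => if j = n then 1 else 0)
    (fun j => by split_ifs <;> norm_num)
  rwa [countExp_const] at this

theorem countProb_pos {p : Site → ℝ} (h0 : ∀ x, 0 < p x) (h1 : ∀ x, p x < 1)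
    (s : Finset Site) : ∀ n : ℤ, 0 ≤ n → n ≤ s.card → 0 < countProb p s n := by
  induction s using Finset.induction_on with
  | empty =>
    intro n hn hn'
    have : n = 0 := le_antisymm (by simpa using hn') hn
    simp [countProb_empty, this]
  | insert x s hx ih =>
    intro n hn hn'
    rw [Finset.card_insert_of_notMem hx] at hn'
    push_cast at hn'
    rw [countProb_insert p hx]
    have hp := h0 x
    have hp' : 0 < 1 - p x := by linarith [h1 x]
    rcases hn'.lt_or_eq with h | h
    · exact add_pos_of_pos_of_nonneg (mul_pos hp' (ih n hn (by omega)))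
        (mul_nonneg hp.le (countProb_nonneg h0 h1 s _))
    · exact add_pos_of_nonneg_of_pos (mul_nonneg hp'.le (countProb_nonneg h0 h1 s _))
        (mul_pos hp (ih (n - 1) (by omega) (by omega)))

/-- The law of the number of particles is log-concave. -/
theorem countProb_logConcave {p : Site → ℝ} (h0 : ∀ x, 0 < p x) (h1 : ∀ x, p x < 1)
    (s : Finset Site) : ∀ i j : ℤ, i ≤ j →
      countProb p s i * countProb p s (j + 1) ≤ countProb p s (i + 1) * countProb p s j := by
  induction s using Finset.induction_on with
  | empty =>
    intro i j hij
    have : ¬(i = 0 ∧ j + 1 = 0) := by omega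
    simp only [countProb_empty]
    split_ifs <;> simp_all
  | insert x s hx ih =>
    intro i j hij
    simp only [countProb_insert p hx, add_sub_cancel_right]
    have hp := (h0 x).le
    have hp' : 0 ≤ 1 - p x := by linarith [h1 x]
    set a := countProb p s
    have e1 := ih i j hij
    have e2 : a (i - 1) * a j ≤ a i * a (j - 1) := by
      simpa using ih (i - 1) (j - 1) (by omega)
    -- In the cross terms, with coefficient `p (1 - p)`, the products `a i * a j` cancel and this
    -- inequality remains. It is two applications of log-concavity, or an equality when `i = j`.
    have e3 : a (i - 1) * a (j + 1) ≤ a (i + 1) * a (j - 1) := by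
      rcases hij.lt_or_eq with h | rfl
      · have f1 : a (i - 1) * a (j + 1) ≤ a i * a j := by
          simpa using ih (i - 1) j (by omega)
        have f2 : a i * a j ≤ a (i + 1) * a (j - 1) := by
          simpa using ih i (j - 1) (by omega)
        exact f1.trans f2
      · rw [mul_comm]
    have g1 := mul_le_mul_of_nonneg_left e1 (mul_nonneg hp' hp')
    have g2 := mul_le_mul_of_nonneg_left e2 (mul_nonneg hp hp)
    have g3 := mul_le_mul_of_nonneg_left e3 (mul_nonneg hp' hp)
    linear_combination g1 + g2 + g3

/-- Passes from configurations to values of the particle number, where the law can be shifted and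
reflected; integer values avoid truncated subtraction. -/
theorem hasSum_countProb (p : Site → ℝ) (s : Finset Site) (F : ℤ → ℝ) :
    HasSum (fun j => countProb p s j * F j) (countExp p s F) := by
  have : (fun j => countProb p s j * F j) =
      fun j => ∑ α : Config s, if j = (particles α : ℤ) then weight p α * F (particles α) else 0 := by
    funext j
    rw [countProb, countExp, Finset.sum_mul]
    refine Finset.sum_congr rfl fun α _ => ?_
    by_cases h : j = (particles α : ℤ)
    · simp [h]
    · simp [h, Ne.symm h]
  rw [this]
  exact hasSum_sum fun α _ => hasSum_ite_eq _ _

/-! ### Moments -/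

/-- The mean number of particles. -/
def mean (p : Site → ℝ) (s : Finset Site) : ℝ := ∑ x ∈ s, p x

/-- The variance of the number of particles. -/
def vari (p : Site → ℝ) (s : Finset Site) : ℝ := ∑ x ∈ s, p x * (1 - p x)

theorem countExp_id (p : Site → ℝ) (s : Finset Site) :
    countExp p s (fun j => (j : ℝ)) = mean p s := by
  induction s using Finset.induction_on with
  | empty => simp [countExp_empty, mean]
  | insert x s hx ih =>
    rw [countExp_insert p hx]
    simp only [Int.cast_add, Int.cast_one]
    rw [countExp_add, ih, countExp_const, mean, mean, Finset.sum_insert hx]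
    ring

theorem countExp_central (p : Site → ℝ) (s : Finset Site) :
    countExp p s (fun j => (j : ℝ) - mean p s) = 0 := by
  simp only [sub_eq_add_neg]
  rw [countExp_add, countExp_id, countExp_const]
  ring

theorem countExp_central_two (p : Site → ℝ) (s : Finset Site) :
    countExp p s (fun j => ((j : ℝ) - mean p s) ^ 2) = vari p s := by
  induction s using Finset.induction_on with
  | empty => simp [countExp_empty, mean, vari]
  | insert x s hx ih =>
    have e : mean p (insert x s) = p x + mean p s := Finset.sum_insert hx
    have e' : vari p (insert x s) = p x * (1 - p x) + vari p s := Finset.sum_insert hx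
    -- Adding a site shifts the centred count by `-p x` or `1 - p x`; the term linear in the centred
    -- count averages to zero.
    have k : ∀ c : ℝ, countExp p s (fun j => ((j : ℝ) - mean p s + c) ^ 2) = vari p s + c ^ 2 := by
      intro c
      have : ∀ j : ℤ, ((j : ℝ) - mean p s + c) ^ 2 =
          ((j : ℝ) - mean p s) ^ 2 + (2 * c * ((j : ℝ) - mean p s) + c ^ 2) := fun j => by ring
      simp only [this]
      rw [countExp_add, countExp_add, countExp_const_mul, countExp_central, countExp_const, ih]
      ring
    rw [countExp_insert p hx, e, e']
    have k1 := k (-p x)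
    have k2 := k (1 - p x)
    have r1 : ∀ j : ℤ, (j : ℝ) - (p x + mean p s) = (j : ℝ) - mean p s + -p x := fun j => by ring
    have r2 : ∀ j : ℤ, ((j + 1 : ℤ) : ℝ) - (p x + mean p s) = (j : ℝ) - mean p s + (1 - p x) :=
      fun j => by push_cast; ring
    simp only [r2]
    simp only [r1, k1, k2]
    ring

/-- The shifts `-p x` and `1 - p x` average to zero, so the third moment drops out of the recursion.
With `v = p x (1 - p x)`, the new site adds `6 v V + v (1 - 3 v)`, whereas the bound grows by `6 v V
+ 3 v² + v`. -/
theorem countExp_central_four {p : Site → ℝ} (h0 : ∀ x, 0 < p x) (h1 : ∀ x, p x < 1)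
    (s : Finset Site) :
    countExp p s (fun j => ((j : ℝ) - mean p s) ^ 4) ≤ 3 * vari p s ^ 2 + vari p s := by
  induction s using Finset.induction_on with
  | empty => simp [countExp_empty, mean, vari]
  | insert x s hx ih =>
    have e : mean p (insert x s) = p x + mean p s := Finset.sum_insert hx
    have e' : vari p (insert x s) = p x * (1 - p x) + vari p s := Finset.sum_insert hx
    set M3 := countExp p s (fun j => ((j : ℝ) - mean p s) ^ 3)
    set M4 := countExp p s (fun j => ((j : ℝ) - mean p s) ^ 4)
    have k : ∀ c : ℝ, countExp p s (fun j => ((j : ℝ) - mean p s + c) ^ 4) =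
        M4 + 4 * c * M3 + 6 * c ^ 2 * vari p s + c ^ 4 := by
      intro c
      have : ∀ j : ℤ, ((j : ℝ) - mean p s + c) ^ 4 =
          ((j : ℝ) - mean p s) ^ 4 + (4 * c * ((j : ℝ) - mean p s) ^ 3 +
            (6 * c ^ 2 * ((j : ℝ) - mean p s) ^ 2 +
              (4 * c ^ 3 * ((j : ℝ) - mean p s) + c ^ 4))) := fun j => by ring
      simp only [this]
      rw [countExp_add, countExp_add, countExp_add, countExp_add, countExp_const_mul,
        countExp_const_mul, countExp_const_mul, countExp_central, countExp_const,
        countExp_central_two]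
      ring
    rw [countExp_insert p hx, e, e']
    have k1 := k (-p x)
    have k2 := k (1 - p x)
    have r1 : ∀ j : ℤ, (j : ℝ) - (p x + mean p s) = (j : ℝ) - mean p s + -p x := fun j => by ring
    have r2 : ∀ j : ℤ, ((j + 1 : ℤ) : ℝ) - (p x + mean p s) = (j : ℝ) - mean p s + (1 - p x) :=
      fun j => by push_cast; ring
    simp only [r2]
    simp only [r1, k1, k2]
    have hv : 0 ≤ p x * (1 - p x) := mul_nonneg (h0 x).le (by linarith [h1 x])
    nlinarith [mul_nonneg hv hv]

/-- The mean absolute deviation is of the order of the standard deviation. -/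
theorem sqrt_vari_le {p : Site → ℝ} (h0 : ∀ x, 0 < p x) (h1 : ∀ x, p x < 1)
    (s : Finset Site) (hv : 1 ≤ vari p s) :
    √(vari p s) ≤ 6 * countExp p s (fun j => |(j : ℝ) - mean p s|) := by
  set S := √(vari p s) with hS
  have hS1 : 1 ≤ S := Real.one_le_sqrt.2 hv
  have hSS : S ^ 2 = vari p s := Real.sq_sqrt (by linarith)
  set A := countExp p s (fun j => |(j : ℝ) - mean p s|)
  -- Cut at `|y| = 3 S`: the linear term dominates below, the quartic one above. On average the left
  -- side is `9 S⁴` and the quartic term at most `3 S⁴ + S² ≤ 4 S⁴`, which leaves `5 S⁴ ≤ 27 S³ A`.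
  have hpt : ∀ j : ℤ, 9 * S ^ 2 * ((j : ℝ) - mean p s) ^ 2 ≤
      27 * S ^ 3 * |(j : ℝ) - mean p s| + ((j : ℝ) - mean p s) ^ 4 := by
    intro j
    set y := (j : ℝ) - mean p s
    have hy : 0 ≤ |y| := abs_nonneg y
    rw [← sq_abs y, ← Even.pow_abs (by decide : Even 4) y]
    rcases le_total |y| (3 * S) with h | h
    · nlinarith [mul_nonneg (mul_nonneg (sq_nonneg S) hy) (sub_nonneg.2 h), pow_nonneg hy 4]
    · have : (3 * S) ^ 2 ≤ |y| ^ 2 := pow_le_pow_left₀ (by linarith) h 2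
      have h3 : 0 ≤ 27 * S ^ 3 * |y| := by positivity
      nlinarith [mul_le_mul_of_nonneg_right this (sq_nonneg |y|)]
  have := countExp_mono h0 h1 s hpt
  rw [countExp_add, countExp_const_mul, countExp_const_mul, countExp_central_two, ← hSS] at this
  have h4 := countExp_central_four h0 h1 s
  rw [← hSS] at h4
  have h5 : S ^ 2 ≤ S ^ 4 := pow_le_pow_right₀ hS1 (by norm_num)
  have h6 : 5 * S ^ 4 ≤ 27 * S ^ 3 * A := by nlinarith
  have h7 : 0 < S ^ 3 := by positivity
  have h8 : S ^ 3 * (5 * S) ≤ S ^ 3 * (27 * A) := by nlinarith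
  have := le_of_mul_le_mul_left h8 h7
  linarith

/-! ### Flatness of the law of the number of particles near its mean -/

/-- With `D` the sum to be bounded, geometric growth and a shift of the index give `(1 + ε) D ≤ ∑ b
j (n + 2 - j)₊ ≤ D + 1`. A general `b` allows use for the reflected law too. -/
theorem tail_le {b : ℤ → ℝ} (hfin : b.support.Finite) (hb : ∀ j, 0 ≤ b j) (hb1 : HasSum b 1)
    {ε : ℝ} (hε : 0 < ε) (n : ℤ) (hg : ∀ j ≤ n, (1 + ε) * b j ≤ b (j + 1)) :
    ∑' j, b j * max ((n : ℝ) + 1 - j) 0 ≤ 1 / ε := by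
  have hsum : ∀ F : ℤ → ℝ, Summable fun j => b j * F j := fun F =>
    summable_of_hasFiniteSupport (hfin.subset fun j hj => by
      simp only [Function.mem_support] at hj ⊢
      exact left_ne_zero_of_mul hj)
  set D := ∑' j, b j * max ((n : ℝ) + 1 - j) 0 with hD
  have hD0 : HasSum (fun j => b j * max ((n : ℝ) + 1 - j) 0) D := (hsum _).hasSum
  have hs2 := (hsum fun j => max ((n : ℝ) + 2 - j) 0).hasSum
  have hs3 := (Equiv.addRight (1 : ℤ)).hasSum_iff.2 hs2
  have i1 : (1 + ε) * D ≤ ∑' j, b j * max ((n : ℝ) + 2 - j) 0 := by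
    refine hasSum_le (fun j => ?_) (hD0.mul_left (1 + ε)) hs3
    have : (n : ℝ) + 2 - ((j + 1 : ℤ) : ℝ) = (n : ℝ) + 1 - j := by push_cast; ring
    simp only [Function.comp_apply, Equiv.coe_addRight, this]
    rw [← mul_assoc]
    rcases le_or_gt j n with h | h
    · exact mul_le_mul_of_nonneg_right (hg j h) (le_max_right _ _)
    · have : ((n : ℝ) + 1 - j) ≤ 0 := by
        have : (n : ℝ) + 1 ≤ j := by exact_mod_cast h
        linarith
      simp [max_eq_right this]
  have i2 : ∑' j, b j * max ((n : ℝ) + 2 - j) 0 ≤ D + 1 := by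
    refine hasSum_le (fun j => ?_) hs2 (hD0.add hb1)
    have : max ((n : ℝ) + 2 - j) 0 ≤ max ((n : ℝ) + 1 - j) 0 + 1 := by
      refine max_le ?_ ?_
      · linarith [le_max_left ((n : ℝ) + 1 - j) 0]
      · linarith [le_max_right ((n : ℝ) + 1 - j) 0]
    nlinarith [mul_le_mul_of_nonneg_left this (hb j)]
  rw [le_div_iff₀ hε]
  linarith

theorem finite_support_countProb (p : Site → ℝ) (s : Finset Site) :
    (countProb p s).support.Finite := by
  refine (Set.finite_range fun α : Config s => (particles α : ℤ)).subset fun j hj => ?_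
  by_contra hne
  refine hj (Finset.sum_eq_zero fun α _ => ?_)
  have : (particles α : ℤ) ≠ j := fun h => hne ⟨α, h⟩
  simp [this]

theorem hasSum_countProb_one (p : Site → ℝ) (s : Finset Site) : HasSum (countProb p s) 1 := by
  simpa [countExp_one] using hasSum_countProb p s fun _ => 1

/-- If the law of the number of particles increases geometrically up to a point close to the mean,
then its variance is bounded. -/
theorem vari_le_of_lt_countProb_succ {p : Site → ℝ} (h0 : ∀ x, 0 < p x) (h1 : ∀ x, p x < 1)
    (s : Finset Site) {ε M : ℝ} (hε : 0 < ε) (n : ℤ) (hn : |(n : ℝ) - mean p s| ≤ M)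
    (hv : 1 ≤ vari p s) (hlt : (1 + ε) * countProb p s n < countProb p s (n + 1)) :
    √(vari p s) ≤ 12 * (M + 1 / ε) := by
  have hnn := countProb_nonneg h0 h1 s
  -- Log-concavity carries the ratio at `n` down to every `j ≤ n`; if the law vanishes at `n`, it
  -- vanishes at all these `j`.
  have hg : ∀ j ≤ n, (1 + ε) * countProb p s j ≤ countProb p s (j + 1) := by
    intro j hj
    have hlc := countProb_logConcave h0 h1 s j n hj
    rcases (hnn n).lt_or_eq with h | h
    · have := mul_le_mul_of_nonneg_left hlt.le (hnn j)
      refine le_of_mul_le_mul_right ?_ h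
      nlinarith
    · rw [← h] at hlc hlt
      have h2 : 0 < countProb p s (n + 1) := by simpa using hlt
      have : countProb p s j = 0 := le_antisymm (by nlinarith) (hnn j)
      rw [this]; simpa using hnn (j + 1)
  have ht := tail_le (finite_support_countProb p s) hnn (hasSum_countProb_one p s) hε n hg
  rw [(hasSum_countProb p s _).tsum_eq] at ht
  have hA : countExp p s (fun j => |(j : ℝ) - mean p s|) ≤ 2 * (M + 1 / ε) := by
    -- This is `|y| = y + 2 y₋` with `y₋ ≤ M + (n + 1 - j)₊`; the term `y` has mean zero.
    have hpt : ∀ j : ℤ, |(j : ℝ) - mean p s| ≤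
        ((j : ℝ) - mean p s) + (2 * M + 2 * max ((n : ℝ) + 1 - j) 0) := by
      intro j
      have a1 := abs_le.1 hn
      have a2 := le_max_left ((n : ℝ) + 1 - j) 0
      have a3 := le_max_right ((n : ℝ) + 1 - j) 0
      exact abs_le.2 ⟨by linarith, by linarith⟩
    have := countExp_mono h0 h1 s hpt
    rw [countExp_add, countExp_add, countExp_central, countExp_const, countExp_const_mul] at this
    linarith
  linarith [sqrt_vari_le h0 h1 s hv]

theorem hasSum_comp_neg {f : ℤ → ℝ} {a : ℝ} (h : HasSum f a) : HasSum (fun j => f (-j)) a :=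
  (Equiv.neg ℤ).hasSum_iff.2 h

/-- The estimate `tail_le` for the law reflected by `j ↦ -j`, at the point `-(n + 1)`. -/
theorem countExp_posPart_le {p : Site → ℝ} (h0 : ∀ x, 0 < p x) (h1 : ∀ x, p x < 1)
    (s : Finset Site) {ε : ℝ} (hε : 0 < ε) (n : ℤ)
    (hg : ∀ j ≤ -(n + 1), (1 + ε) * countProb p s (-j) ≤ countProb p s (-(j + 1))) :
    countExp p s (fun j => max ((j : ℝ) - n) 0) ≤ 1 / ε := by
  have hnn := countProb_nonneg h0 h1 s
  have hfin : (fun j => countProb p s (-j)).support.Finite :=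
    (finite_support_countProb p s).preimage neg_injective.injOn
  have ht := tail_le hfin (fun j => hnn (-j)) (hasSum_comp_neg (hasSum_countProb_one p s)) hε
    (-(n + 1)) hg
  have h := hasSum_comp_neg (hasSum_countProb p s fun j => max ((j : ℝ) - n) 0)
  rw [← h.tsum_eq]
  convert ht using 5 with j
  push_cast
  ring

/-- If the law of the number of particles decreases geometrically from a point close to the mean,
then its variance is bounded. -/
theorem vari_le_of_countProb_succ_lt {p : Site → ℝ} (h0 : ∀ x, 0 < p x) (h1 : ∀ x, p x < 1)
    (s : Finset Site) {ε M : ℝ} (hε : 0 < ε) (n : ℤ) (hn : |(n : ℝ) - mean p s| ≤ M)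
    (hv : 1 ≤ vari p s) (hlt : (1 + ε) * countProb p s (n + 1) < countProb p s n) :
    √(vari p s) ≤ 12 * (M + 1 / ε) := by
  have hnn := countProb_nonneg h0 h1 s
  have hg : ∀ j ≤ -(n + 1), (1 + ε) * countProb p s (-j) ≤ countProb p s (-(j + 1)) := by
    intro j hj
    have hlc := countProb_logConcave h0 h1 s n (-(j + 1)) (by omega)
    rw [show -(j + 1) + 1 = -j by ring] at hlc
    rcases (hnn (n + 1)).lt_or_eq with h | h
    · have := mul_le_mul_of_nonneg_left hlt.le (hnn (-j))
      refine le_of_mul_le_mul_right ?_ h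
      nlinarith
    · rw [← h] at hlc hlt
      have h2 : 0 < countProb p s n := by simpa using hlt
      have : countProb p s (-j) = 0 := le_antisymm (by nlinarith) (hnn _)
      rw [this]; simpa using hnn _
  have ht := countExp_posPart_le h0 h1 s hε n hg
  have hA : countExp p s (fun j => |(j : ℝ) - mean p s|) ≤ 2 * (M + 1 / ε) := by
    have hpt : ∀ j : ℤ, |(j : ℝ) - mean p s| ≤
        (-1) * ((j : ℝ) - mean p s) + (2 * M + 2 * max ((j : ℝ) - n) 0) := by
      intro j
      have a1 := abs_le.1 hn
      have a2 := le_max_left ((j : ℝ) - n) 0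
      have a3 := le_max_right ((j : ℝ) - n) 0
      exact abs_le.2 ⟨by linarith, by linarith⟩
    have := countExp_mono h0 h1 s hpt
    rw [countExp_add, countExp_add, countExp_const_mul, countExp_central, countExp_const,
      countExp_const_mul] at this
    linarith
  linarith [sqrt_vari_le h0 h1 s hv]

theorem vari_le_mean {p : Site → ℝ} (h0 : ∀ x, 0 < p x) (s : Finset Site) :
    vari p s ≤ mean p s :=
  Finset.sum_le_sum fun x _ => by nlinarith [h0 x]

theorem vari_le_card_sub_mean {p : Site → ℝ} (h1 : ∀ x, p x < 1) (s : Finset Site) :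
    vari p s ≤ s.card - mean p s := by
  have : (s.card : ℝ) - mean p s = ∑ x ∈ s, (1 - p x) := by simp [mean]
  rw [this]
  exact Finset.sum_le_sum fun x _ => by nlinarith [h1 x]

/-! ### Flatness along sequences with diverging variance -/

section Sequences

variable {p : ℕ → Site → ℝ} {s : ℕ → Finset Site} {n : ℕ → ℤ} {M : ℝ}

/-- The variance is at most the mean and at most the cardinality minus the mean, so once it exceeds
`M` the integer `n k` is an attainable particle number. -/
theorem eventually_countProb_pos (h0 : ∀ k x, 0 < p k x) (h1 : ∀ k x, p k x < 1)
    (hn : ∀ᶠ k in atTop, |(n k : ℝ) - mean (p k) (s k)| ≤ M)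
    (hv : Tendsto (fun k => vari (p k) (s k)) atTop atTop) :
    ∀ᶠ k in atTop, 0 < countProb (p k) (s k) (n k) := by
  filter_upwards [hn, hv.eventually_ge_atTop M] with k hk hvk
  have a := abs_le.1 hk
  have b := vari_le_mean (h0 k) (s k)
  have c := vari_le_card_sub_mean (h1 k) (s k)
  refine countProb_pos (h0 k) (h1 k) _ _ ?_ ?_
  · have : (0 : ℝ) ≤ n k := by linarith
    exact_mod_cast this
  · have : (n k : ℝ) ≤ (s k).card := by linarith
    exact_mod_cast this

/-- Near the mean consecutive values of the law of the number of particles are asymptotically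
equal when the variance diverges. -/
theorem tendsto_countProb_succ_div (h0 : ∀ k x, 0 < p k x) (h1 : ∀ k x, p k x < 1)
    (hn : ∀ᶠ k in atTop, |(n k : ℝ) - mean (p k) (s k)| ≤ M)
    (hv : Tendsto (fun k => vari (p k) (s k)) atTop atTop) :
    Tendsto (fun k => countProb (p k) (s k) (n k + 1) / countProb (p k) (s k) (n k)) atTop
      (𝓝 1) := by
  rw [Metric.tendsto_nhds]
  intro ε hε
  have hδ : 0 < ε / 2 := by linarith
  have hsq := Real.tendsto_sqrt_atTop.comp hv
  filter_upwards [hn, hv.eventually_ge_atTop 1, hsq.eventually_gt_atTop (12 * (M + 1 / (ε / 2))),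
    eventually_countProb_pos h0 h1 hn hv] with k hk hvk hs hpos
  have u1 : countProb (p k) (s k) (n k + 1) ≤ (1 + ε / 2) * countProb (p k) (s k) (n k) := by
    by_contra! h
    exact absurd (vari_le_of_lt_countProb_succ (h0 k) (h1 k) _ hδ _ hk hvk h) (not_le.2 hs)
  have u2 : countProb (p k) (s k) (n k) ≤ (1 + ε / 2) * countProb (p k) (s k) (n k + 1) := by
    by_contra! h
    exact absurd (vari_le_of_countProb_succ_lt (h0 k) (h1 k) _ hδ _ hk hvk h) (not_le.2 hs)
  have hr : countProb (p k) (s k) (n k + 1) / countProb (p k) (s k) (n k) ≤ 1 + ε / 2 :=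
    (div_le_iff₀ hpos).2 u1
  have hr2 : 1 ≤ (1 + ε / 2) *
      (countProb (p k) (s k) (n k + 1) / countProb (p k) (s k) (n k)) := by
    rw [← mul_div_assoc]
    exact (one_le_div hpos).2 u2
  rw [Real.dist_eq, abs_lt]
  constructor <;> nlinarith

/-- Telescoping into consecutive ratios, all taken at a bounded distance from the mean. -/
theorem tendsto_countProb_sub_div (h0 : ∀ k x, 0 < p k x) (h1 : ∀ k x, p k x < 1)
    (hn : ∀ᶠ k in atTop, |(n k : ℝ) - mean (p k) (s k)| ≤ M)
    (hv : Tendsto (fun k => vari (p k) (s k)) atTop atTop) (i : ℕ) :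
    Tendsto (fun k => countProb (p k) (s k) (n k - i) / countProb (p k) (s k) (n k)) atTop
      (𝓝 1) := by
  induction i with
  | zero =>
    refine tendsto_const_nhds.congr' ?_
    filter_upwards [eventually_countProb_pos h0 h1 hn hv] with k hk
    simp [hk.ne']
  | succ i ih =>
    have hbd : ∀ᶠ k in atTop, |((n k - (i + 1) : ℤ) : ℝ) - mean (p k) (s k)| ≤ M + (i + 1) := by
      filter_upwards [hn] with k hk
      have := abs_le.1 hk
      push_cast
      exact abs_le.2 ⟨by linarith, by linarith⟩
    have h2 := (tendsto_countProb_succ_div h0 h1 hbd hv).inv₀ one_ne_zero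
    have h3 := ih.mul h2
    simp only [inv_one, mul_one] at h3
    refine h3.congr' ?_
    have hbd' : ∀ᶠ k in atTop, |((n k - i : ℤ) : ℝ) - mean (p k) (s k)| ≤ M + i := by
      filter_upwards [hn] with k hk
      have := abs_le.1 hk
      push_cast
      exact abs_le.2 ⟨by linarith, by linarith⟩
    filter_upwards [eventually_countProb_pos h0 h1 hbd' hv] with k hk
    rw [show n k - (i + 1 : ℤ) + 1 = n k - i by ring, inv_div, Nat.cast_succ]
    field_simp

end Sequences

/-! ### The product state and its particle statistics -/

/-- The occupation probability of the site `x` in the grand canonical state. -/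
noncomputable def occ (q μ : ℝ) (x : Site) : ℝ :=
  q ^ (2 * ((height x : ℝ) - μ)) / (1 + q ^ (2 * ((height x : ℝ) - μ)))

/-- The amplitudes of the normalized one-site vectors of the grand canonical state. -/
noncomputable def amp (q μ : ℝ) (x : Site) (i : Fin 2) : ℝ :=
  (if i = 0 then 1 else q ^ ((height x : ℝ) - μ)) / √(1 + q ^ (2 * ((height x : ℝ) - μ)))

/-- The amplitudes of the normalized grand canonical product vector. -/
noncomputable def prodAmp (q μ : ℝ) {Λ : Finset Site} (α : Config Λ) : ℝ :=
  ∏ x : Λ, amp q μ x.1 (α x)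

theorem one_add_rpow_pos {q : ℝ} (hq : 0 < q) (t : ℝ) : 0 < 1 + q ^ t := by
  have := Real.rpow_pos_of_pos hq t
  linarith

theorem occ_pos {q : ℝ} (hq : 0 < q) (μ : ℝ) (x : Site) : 0 < occ q μ x :=
  div_pos (Real.rpow_pos_of_pos hq _) (one_add_rpow_pos hq _)

theorem occ_lt_one {q : ℝ} (hq : 0 < q) (μ : ℝ) (x : Site) : occ q μ x < 1 := by
  rw [occ, div_lt_one (one_add_rpow_pos hq _)]
  linarith

theorem one_sub_occ {q : ℝ} (hq : 0 < q) (μ : ℝ) (x : Site) :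
    1 - occ q μ x = 1 / (1 + q ^ (2 * ((height x : ℝ) - μ))) := by
  have := (one_add_rpow_pos hq (2 * ((height x : ℝ) - μ))).ne'
  rw [occ]
  field_simp
  ring

theorem amp_sq {q : ℝ} (hq : 0 < q) (μ : ℝ) (x : Site) (i : Fin 2) :
    amp q μ x i ^ 2 = if i = 0 then 1 - occ q μ x else occ q μ x := by
  rw [amp, div_pow, Real.sq_sqrt (one_add_rpow_pos hq _).le]
  split_ifs
  · rw [one_sub_occ hq, one_pow]
  · rw [occ, two_mul, Real.rpow_add hq, sq]

theorem prodAmp_sq {q : ℝ} (hq : 0 < q) (μ : ℝ) {Λ : Finset Site} (α : Config Λ) :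
    prodAmp q μ α ^ 2 = weight (occ q μ) α := by
  rw [prodAmp, weight, ← Finset.prod_pow]
  exact Finset.prod_congr rfl fun x _ => amp_sq hq μ x.1 (α x)

theorem prodAmp_glue (q μ : ℝ) {Λ₀ Λ : Finset Site} (h : Λ₀ ⊆ Λ)
    (σ : Config Λ₀) (η : Config (Λ \ Λ₀)) :
    prodAmp q μ (glue σ η : Config Λ) = prodAmp q μ σ * prodAmp q μ η :=
  prod_glue h (amp q μ) σ η

theorem productVec_eq (q μ : ℝ) {Λ : Finset Site} (α : Config Λ) :
    productVec q Λ μ α = (prodAmp q μ α : ℂ) := by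
  simp only [productVec, prodAmp, amp, Complex.ofReal_prod]
  refine Finset.prod_congr rfl fun x _ => ?_
  split_ifs <;> push_cast <;> rfl

theorem expval_smul {Λ : Finset Site} {c : ℂ} (hc : c ≠ 0) (ψ : Vec Λ) (X : Obs Λ) :
    expval (c • ψ) X = expval ψ X := by
  have hc' : star c ≠ 0 := star_ne_zero.2 hc
  simp only [expval, star_smul, Matrix.mulVec_smul, smul_dotProduct, dotProduct_smul, smul_eq_mul]
  rw [mul_div_mul_left _ _ hc, mul_div_mul_left _ _ hc']

/-- The product of the norms of the one-site vectors. -/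
noncomputable def normProd (q μ : ℝ) (Λ : Finset Site) : ℝ :=
  ∏ x : Λ, √(1 + q ^ (2 * ((height x.1 : ℝ) - μ)))

theorem normProd_pos {q : ℝ} (hq : 0 < q) (μ : ℝ) (Λ : Finset Site) : 0 < normProd q μ Λ :=
  Finset.prod_pos fun _ _ => Real.sqrt_pos.2 (one_add_rpow_pos hq _)

theorem normProd_mul_prodAmp {q : ℝ} (hq : 0 < q) (μ : ℝ) {Λ : Finset Site} (α : Config Λ) :
    normProd q μ Λ * prodAmp q μ α =
      ∏ x : Λ, if α x = 0 then 1 else q ^ ((height x.1 : ℝ) - μ) := by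
  rw [normProd, prodAmp, ← Finset.prod_mul_distrib]
  refine Finset.prod_congr rfl fun x _ => ?_
  rw [amp, mul_div_cancel₀ _ (Real.sqrt_pos.2 (one_add_rpow_pos hq _)).ne']

theorem grandCanonicalVec_eq {q : ℝ} (hq : 0 < q) (μ : ℝ) (Λ : Finset Site) :
    grandCanonicalVec q Λ μ = (normProd q μ Λ : ℂ) • fun α => (prodAmp q μ α : ℂ) := by
  funext α
  rw [Pi.smul_apply, smul_eq_mul, ← Complex.ofReal_mul, normProd_mul_prodAmp hq, Complex.ofReal_prod]
  refine Finset.prod_congr rfl fun x _ => ?_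
  split_ifs <;> push_cast <;> rfl

/-! ### Canonical vectors as sectors of the product vector -/

/-- The component with `n` particles of the normalized grand canonical product vector. -/
noncomputable def sectorVec (q μ : ℝ) (Λ : Finset Site) (n : ℕ) : Vec Λ := fun α =>
  if particles α = n then (prodAmp q μ α : ℂ) else 0

/-- With `n` particles, replacing `l(x)` by `l(x) - μ` only costs the constant `q ^ (μ * n)`; so `μ`
is free and can later be taken to be `μ_k`. -/
theorem canonicalVec_eq {q : ℝ} (hq : 0 < q) (μ : ℝ) (Λ : Finset Site) (n : ℕ) :
    canonicalVec q Λ n = ((q ^ (μ * n) * normProd q μ Λ : ℝ) : ℂ) • sectorVec q μ Λ n := by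
  funext α
  rw [Pi.smul_apply, smul_eq_mul, canonicalVec, sectorVec]
  split_ifs with h
  · rw [← Complex.ofReal_mul, mul_assoc, normProd_mul_prodAmp hq, ← h, particles, Nat.cast_sum,
      Finset.mul_sum, Real.rpow_sum_of_pos hq, ← Finset.prod_mul_distrib, Complex.ofReal_prod]
    refine Finset.prod_congr rfl fun x _ => ?_
    generalize α x = i
    fin_cases i
    · simp
    · have : q ^ μ * q ^ ((height x.1 : ℝ) - μ) = q ^ (height x.1) := by
        rw [← Real.rpow_add hq, add_sub_cancel, Real.rpow_intCast]
      simp [this]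
  · rw [mul_zero]

theorem canonicalAvg_eq {q : ℝ} (hq : 0 < q) (μ : ℝ) {Λ₀ Λ : Finset Site} (h : Λ₀ ⊆ Λ) (n : ℕ)
    (X : Obs Λ₀) : canonicalAvg q Λ n X = expval (sectorVec q μ Λ n) (embed h X) := by
  rw [canonicalAvg, dif_pos h, canonicalVec_eq hq μ, expval_smul]
  exact Complex.ofReal_ne_zero.2
    (mul_pos (Real.rpow_pos_of_pos hq _) (normProd_pos hq μ Λ)).ne'

theorem grandCanonicalNumber_eq {q : ℝ} (hq : 0 < q) (μ : ℝ) (Λ : Finset Site) :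
    grandCanonicalNumber q Λ μ = (mean (occ q μ) Λ : ℂ) := by
  rw [grandCanonicalNumber, grandCanonicalVec_eq hq,
    expval_smul (Complex.ofReal_ne_zero.2 (normProd_pos hq μ Λ).ne'), expval]
  have h1 : (star fun α : Config Λ => (prodAmp q μ α : ℂ)) ⬝ᵥ
      (fun α : Config Λ => (prodAmp q μ α : ℂ)) = 1 := by
    rw [← Complex.ofReal_one, ← countExp_one (occ q μ) Λ, countExp, dotProduct,
      Complex.ofReal_sum]
    refine Finset.sum_congr rfl fun α _ => ?_
    rw [← prodAmp_sq hq]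
    simp [sq]
  have h2 : (star fun α : Config Λ => (prodAmp q μ α : ℂ)) ⬝ᵥ
      (numberOp Λ).mulVec (fun α : Config Λ => (prodAmp q μ α : ℂ)) = mean (occ q μ) Λ := by
    rw [← countExp_id, countExp, dotProduct, Complex.ofReal_sum]
    refine Finset.sum_congr rfl fun α _ => ?_
    rw [← prodAmp_sq hq, numberOp, Matrix.mulVec_diagonal]
    simp
    ring
  rw [h1, h2, div_one]

theorem grandCanonicalAvg_eq (q μ : ℝ) {Λ₀ : Finset Site} (X : Obs Λ₀) :
    grandCanonicalAvg q μ X =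
      ∑ σ : Config Λ₀, ∑ τ : Config Λ₀, (prodAmp q μ σ : ℂ) * X σ τ * prodAmp q μ τ := by
  simp only [grandCanonicalAvg, dotProduct, Matrix.mulVec, Finset.mul_sum, Pi.star_apply,
    productVec_eq]
  refine Finset.sum_congr rfl fun σ _ => Finset.sum_congr rfl fun τ _ => ?_
  simp [mul_assoc]

theorem embed_glue {Λ₀ Λ : Finset Site} (h : Λ₀ ⊆ Λ) (X : Obs Λ₀) (σ τ : Config Λ₀)
    (η ζ : Config (Λ \ Λ₀)) :
    embed h X (glue σ η) (glue τ ζ) = if η = ζ then X σ τ else 0 := by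
  have h1 : ∀ (σ : Config Λ₀) (η : Config (Λ \ Λ₀)),
      (fun x : Λ₀ => (glue σ η : Config Λ) ⟨x.1, h x.2⟩) = σ := by
    intro σ η
    funext x
    simp [glue]
  rw [embed, h1, h1]
  congr 1
  refine propext ⟨fun H => ?_, ?_⟩
  · funext x
    have hx := Finset.mem_sdiff.1 x.2
    simpa [glue, hx.2] using H ⟨x.1, hx.1⟩ hx.2
  · rintro rfl x hx
    simp [glue, hx]

/-- The unnormalized expectation of a local observable in the `n`-particle component. -/
theorem sectorVec_dotProduct {q : ℝ} (hq : 0 < q) (μ : ℝ) {Λ₀ Λ : Finset Site} (h : Λ₀ ⊆ Λ)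
    (n : ℕ) (X : Obs Λ₀) :
    star (sectorVec q μ Λ n) ⬝ᵥ (embed h X).mulVec (sectorVec q μ Λ n) =
      ∑ σ : Config Λ₀, ∑ τ : Config Λ₀, if particles σ = particles τ then
        (prodAmp q μ σ : ℂ) * X σ τ * prodAmp q μ τ *
          (countProb (occ q μ) (Λ \ Λ₀) ((n : ℤ) - (particles σ : ℕ)) : ℝ) else 0 := by
  simp only [dotProduct, Matrix.mulVec]
  rw [← (splitEquiv h).sum_comp, Fintype.sum_prod_type]
  refine Finset.sum_congr rfl fun σ _ => ?_
  simp only [← (splitEquiv h).sum_comp, Fintype.sum_prod_type]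
  simp only [Finset.mul_sum]
  rw [Finset.sum_comm]
  refine Finset.sum_congr rfl fun τ _ => ?_
  simp only [splitEquiv, Equiv.coe_fn_mk, embed_glue, ite_mul, zero_mul, mul_ite, mul_zero,
    Finset.sum_ite_eq, Finset.mem_univ, if_true, Pi.star_apply]
  simp only [sectorVec, particles_glue h, prodAmp_glue q μ h]
  -- One outer configuration `η` must complete both `σ` and `τ` to `n` particles, which is possible
  -- only if they have equally many.
  split_ifs with hp
  · rw [countProb, countExp, Complex.ofReal_sum, Finset.mul_sum]
    refine Finset.sum_congr rfl fun η _ => ?_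
    rw [← prodAmp_sq hq, ← hp]
    have e : (particles η : ℤ) = (n : ℤ) - (particles σ : ℕ) ↔ particles σ + particles η = n := by
      omega
    simp only [e]
    split_ifs
    · simp
      ring
    · simp
  · refine Finset.sum_eq_zero fun η _ => ?_
    split_ifs
    · omega
    all_goals simp

/-- Makes the squared norm of a sector vector the case `X = 1` of `sectorVec_dotProduct`. -/
theorem embed_one {Λ₀ Λ : Finset Site} (h : Λ₀ ⊆ Λ) : embed h (1 : Obs Λ₀) = 1 := by
  ext α β
  obtain ⟨⟨σ, η⟩, rfl⟩ := (splitEquiv h).surjective α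
  obtain ⟨⟨τ, ζ⟩, rfl⟩ := (splitEquiv h).surjective β
  rw [Matrix.one_apply]
  simp only [(splitEquiv h).injective.eq_iff, Prod.mk.injEq]
  simp only [splitEquiv, Equiv.coe_fn_mk, embed_glue, Matrix.one_apply]
  split_ifs <;> simp_all

theorem totalSpinZ_eq (Λ : Finset Site) :
    totalSpinZ Λ = Matrix.diagonal fun α : Config Λ => (Λ.card : ℂ) / 2 - particles α := by
  ext α β
  simp only [totalSpinZ, spinZ, Matrix.sum_apply, Matrix.diagonal_apply]
  split_ifs
  · have : ∀ x : Λ, (if α x = 0 then (1 / 2 : ℂ) else -(1 / 2)) = 1 / 2 - ((α x : ℕ) : ℂ) := by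
      intro x
      generalize α x = i
      fin_cases i <;> norm_num
    simp only [this, Finset.sum_sub_distrib, particles]
    simp [div_eq_mul_inv]
  · simp

/-- Gauge invariant observables preserve the number of particles. -/
theorem apply_eq_zero_of_commute {Λ : Finset Site} {X : Obs Λ} (hX : Commute X (totalSpinZ Λ))
    {σ τ : Config Λ} (h : particles σ ≠ particles τ) : X σ τ = 0 := by
  have := congrFun (congrFun hX.eq σ) τ
  rw [totalSpinZ_eq, Matrix.mul_diagonal, Matrix.diagonal_mul] at this
  have h2 : X σ τ * ((particles σ : ℂ) - particles τ) = 0 := by linear_combination this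
  rcases mul_eq_zero.1 h2 with h3 | h3
  · exact h3
  · exact absurd (by exact_mod_cast sub_eq_zero.1 h3) h

theorem continuous_prodAmp {q : ℝ} (hq : 0 < q) {Λ : Finset Site} (α : Config Λ) :
    Continuous fun μ => prodAmp q μ α := by
  unfold prodAmp amp
  refine continuous_finsetProd _ fun x _ => Continuous.div ?_ ?_ fun μ =>
    (Real.sqrt_pos.2 (one_add_rpow_pos hq _)).ne'
  · split_ifs
    · exact continuous_const
    · exact (Real.continuous_const_rpow hq.ne').comp (by fun_prop)
  · exact (continuous_const.add ((Real.continuous_const_rpow hq.ne').comp (by fun_prop))).sqrt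

theorem continuous_occ {q : ℝ} (hq : 0 < q) (x : Site) : Continuous fun μ => occ q μ x := by
  have : Continuous fun μ : ℝ => q ^ (2 * ((height x : ℝ) - μ)) :=
    (Real.continuous_const_rpow hq.ne').comp (by fun_prop)
  exact this.div (continuous_const.add this) fun μ => (one_add_rpow_pos hq _).ne'

/-- Convergence of the rescaled unnormalized expectations. -/
theorem tendsto_sector_sum {q : ℝ} (hq : 0 < q) {Λ₀ : Finset Site} {X : Obs Λ₀}
    (hX : Commute X (totalSpinZ Λ₀)) {μs : ℕ → ℝ} {μ : ℝ} (hμ : Tendsto μs atTop (𝓝 μ))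
    {r : ℕ → ℕ → ℝ} (hr : ∀ i, Tendsto (fun k => r k i) atTop (𝓝 1)) :
    Tendsto (fun k => ∑ σ : Config Λ₀, ∑ τ : Config Λ₀, if particles σ = particles τ then
        (prodAmp q (μs k) σ : ℂ) * X σ τ * prodAmp q (μs k) τ * (r k (particles σ) : ℂ) else 0)
      atTop (𝓝 (grandCanonicalAvg q μ X)) := by
  rw [grandCanonicalAvg_eq]
  refine tendsto_finsetSum _ fun σ _ => tendsto_finsetSum _ fun τ _ => ?_
  have hc : ∀ α : Config Λ₀, Tendsto (fun k => (prodAmp q (μs k) α : ℂ)) atTop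
      (𝓝 (prodAmp q μ α : ℂ)) := fun α =>
    (Complex.continuous_ofReal.tendsto _).comp
      (((continuous_prodAmp hq α).tendsto μ).comp hμ)
  split_ifs with h
  · have := (((hc σ).mul_const (X σ τ)).mul (hc τ)).mul
      ((Complex.continuous_ofReal.tendsto _).comp (hr (particles σ)))
    simpa using this
  -- Gauge invariance enters here: it removes from the limit the off-diagonal terms that the sector
  -- sums lack.
  · simp [apply_eq_zero_of_commute hX h]

theorem grandCanonicalAvg_one {q : ℝ} (hq : 0 < q) (μ : ℝ) (Λ₀ : Finset Site) :
    grandCanonicalAvg q μ (1 : Obs Λ₀) = 1 := by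
  rw [grandCanonicalAvg_eq, ← Complex.ofReal_one, ← countExp_one (occ q μ) Λ₀, countExp,
    Complex.ofReal_sum]
  refine Finset.sum_congr rfl fun σ _ => ?_
  rw [← prodAmp_sq hq]
  simp [Matrix.one_apply, sq]

/-! ### Equivalence of ensembles -/

theorem abs_mean_sub_mean_sdiff_le {p : Site → ℝ} (h0 : ∀ x, 0 < p x) (h1 : ∀ x, p x < 1)
    {Λ₀ Λ : Finset Site} (h : Λ₀ ⊆ Λ) : |mean p Λ - mean p (Λ \ Λ₀)| ≤ Λ₀.card := by
  have e : mean p (Λ \ Λ₀) + mean p Λ₀ = mean p Λ := Finset.sum_sdiff h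
  have a : 0 ≤ mean p Λ₀ := Finset.sum_nonneg fun x _ => (h0 x).le
  have b : mean p Λ₀ ≤ Λ₀.card := by
    have := Finset.sum_le_sum fun x (_ : x ∈ Λ₀) => (h1 x).le
    simpa [mean] using this
  exact abs_le.2 ⟨by linarith, by linarith⟩

theorem infinite_plane : {x : Site | height x = 0}.Infinite := by
  refine Set.infinite_of_injective_forall_mem (f := fun a : ℤ => (![a, -a, 0] : Site))
    (fun a b hab => ?_) fun a => ?_
  · simpa using congrFun hab 0
  · simp [height]

theorem eventually_subset {Λ : ℕ → Finset Site} (h : Exhausts Λ) (T : Finset Site) :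
    ∀ᶠ k in atTop, T ⊆ Λ k := by
  have : ∀ x ∈ T, ∀ᶠ k in atTop, x ∈ Λ k := fun x _ => by
    obtain ⟨k, hk⟩ := h.2 x
    filter_upwards [eventually_ge_atTop k] with j hj using h.1 hj hk
  exact (Finset.eventually_all T).2 this

/-- Sites of height `0` outside `Λ₀` share one variance, eventually above `c / 2`, and the volumes
eventually contain any finite number of them. -/
theorem tendsto_vari {q : ℝ} (hq : 0 < q) {Λ : ℕ → Finset Site} (h : Exhausts Λ)
    (Λ₀ : Finset Site) {μs : ℕ → ℝ} {μ : ℝ} (hμ : Tendsto μs atTop (𝓝 μ)) :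
    Tendsto (fun k => vari (occ q (μs k)) (Λ k \ Λ₀)) atTop atTop := by
  have hc : Continuous fun ν => occ q ν 0 * (1 - occ q ν 0) :=
    (continuous_occ hq 0).mul (continuous_const.sub (continuous_occ hq 0))
  set c := occ q μ 0 * (1 - occ q μ 0)
  have hcpos : 0 < c := mul_pos (occ_pos hq μ 0) (sub_pos.2 (occ_lt_one hq μ 0))
  rw [tendsto_atTop]
  intro V
  obtain ⟨N, hN⟩ := exists_nat_gt (V / (c / 2))
  obtain ⟨T, hT, hTN⟩ := (infinite_plane.sdiff Λ₀.finite_toSet).exists_subset_card_eq N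
  have hlim := ((hc.tendsto μ).comp hμ).eventually_const_lt (half_lt_self hcpos)
  filter_upwards [hlim, eventually_subset h T] with k hk hTk
  have hsub : T ⊆ Λ k \ Λ₀ := fun x hx =>
    Finset.mem_sdiff.2 ⟨hTk hx, fun hx' => (hT hx).2 hx'⟩
  have h1 : vari (occ q (μs k)) T ≤ vari (occ q (μs k)) (Λ k \ Λ₀) :=
    Finset.sum_le_sum_of_subset_of_nonneg hsub fun x _ _ =>
      mul_nonneg (occ_pos hq _ x).le (sub_nonneg.2 (occ_lt_one hq _ x).le)
  have h2 : vari (occ q (μs k)) T = N * (occ q (μs k) 0 * (1 - occ q (μs k) 0)) := by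
    rw [← hTN, ← nsmul_eq_mul, ← Finset.sum_const]
    refine Finset.sum_congr rfl fun x hx => ?_
    have hx0 : height x = height 0 := (hT hx).1.trans (by simp [height])
    simp only [occ, hx0]
  have h3 : V < N * (c / 2) := (div_lt_iff₀ (by linarith)).1 hN
  have h4 : (N : ℝ) * (c / 2) ≤ N * (occ q (μs k) 0 * (1 - occ q (μs k) 0)) :=
    mul_le_mul_of_nonneg_left hk.le (Nat.cast_nonneg N)
  linarith

/-- Equivalence of ensembles, for arbitrary volumes exhausting the lattice. -/
theorem tendsto_canonicalAvg {q : ℝ} (hq : 0 < q) {Λ : ℕ → Finset Site} (h : Exhausts Λ)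
    {n : ℕ → ℕ} {μs : ℕ → ℝ} {μ : ℝ}
    (hn : ∀ k, grandCanonicalNumber q (Λ k) (μs k) = (n k : ℂ))
    (hμ : Tendsto μs atTop (𝓝 μ)) {Λ₀ : Finset Site} {X : Obs Λ₀}
    (hX : Commute X (totalSpinZ Λ₀)) :
    Tendsto (fun k => canonicalAvg q (Λ k) (n k) X) atTop (𝓝 (grandCanonicalAvg q μ X)) := by
  have hmean : ∀ k, mean (occ q (μs k)) (Λ k) = n k := fun k => by
    have := hn k
    rw [grandCanonicalNumber_eq hq] at this
    exact_mod_cast this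
  have h0 : ∀ k x, 0 < occ q (μs k) x := fun k => occ_pos hq _
  have h1 : ∀ k x, occ q (μs k) x < 1 := fun k => occ_lt_one hq _
  -- Removing `Λ₀` moves the mean away from `n k` by at most `Λ₀.card`.
  have hbd : ∀ᶠ k in atTop,
      |(((n k : ℕ) : ℤ) : ℝ) - mean (occ q (μs k)) (Λ k \ Λ₀)| ≤ (Λ₀.card : ℝ) := by
    filter_upwards [eventually_subset h Λ₀] with k hk
    have := abs_mean_sub_mean_sdiff_le (h0 k) (h1 k) hk
    rw [hmean k] at this
    simpa using this
  have hv := tendsto_vari hq h Λ₀ hμ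
  have hr := tendsto_countProb_sub_div h0 h1 hbd hv
  have hnum := tendsto_sector_sum hq hX hμ hr
  have hden := tendsto_sector_sum hq (Commute.one_left (totalSpinZ Λ₀)) hμ hr
  rw [grandCanonicalAvg_one hq] at hden
  have hdiv := hnum.div hden one_ne_zero
  rw [div_one] at hdiv
  refine hdiv.congr' ?_
  filter_upwards [eventually_subset h Λ₀, eventually_countProb_pos h0 h1 hbd hv] with k hk hpos
  have hP : ((countProb (occ q (μs k)) (Λ k \ Λ₀) (n k) : ℝ) : ℂ) ≠ 0 :=
    Complex.ofReal_ne_zero.2 hpos.ne'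
  have key : ∀ Y : Obs Λ₀, (∑ σ : Config Λ₀, ∑ τ : Config Λ₀, if particles σ = particles τ then
        (prodAmp q (μs k) σ : ℂ) * Y σ τ * prodAmp q (μs k) τ *
          ((countProb (occ q (μs k)) (Λ k \ Λ₀) ((n k : ℤ) - (particles σ : ℕ)) /
            countProb (occ q (μs k)) (Λ k \ Λ₀) (n k) : ℝ) : ℂ) else 0) =
      (star (sectorVec q (μs k) (Λ k) (n k)) ⬝ᵥ
        (embed hk Y).mulVec (sectorVec q (μs k) (Λ k) (n k))) /
          (countProb (occ q (μs k)) (Λ k \ Λ₀) (n k) : ℝ) := by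
    intro Y
    rw [sectorVec_dotProduct hq, Finset.sum_div]
    refine Finset.sum_congr rfl fun σ _ => ?_
    rw [Finset.sum_div]
    refine Finset.sum_congr rfl fun τ _ => ?_
    split_ifs
    · push_cast
      ring
    · simp
  rw [canonicalAvg_eq hq (μs k) hk, expval]
  simp only [Pi.div_apply]
  rw [key, key, embed_one, Matrix.one_mulVec, div_div_div_cancel_right₀ hP]

/-! ### Existence of suitable volumes -/

/-- The point `(a, b, -a-b)` of the plane `l(x) = 0`. -/
def planePoint (a : ℤ × ℤ) : Site := ![a.1, a.2, -a.1 - a.2]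

theorem planePoint_injective : Function.Injective planePoint := fun a b h =>
  Prod.ext (by simpa [planePoint] using congrFun h 0) (by simpa [planePoint] using congrFun h 1)

/-- The cylinder of length `2N + 1` over the square of side `2N + 1`. -/
noncomputable def box (N : ℕ) : Cylinder where
  base := (Finset.Icc (-(N : ℤ)) N ×ˢ Finset.Icc (-(N : ℤ)) N).image planePoint
  base_height x hx := by
    obtain ⟨a, -, rfl⟩ := Finset.mem_image.1 hx
    simp [height, planePoint]
  len := 2 * N
  len_even := even_two_mul N

theorem mem_box_base {N : ℕ} {x : Site} (hx : height x = 0) (h0 : |x 0| ≤ N) (h1 : |x 1| ≤ N) :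
    x ∈ (box N).base := by
  refine Finset.mem_image.2 ⟨(x 0, x 1), ?_, ?_⟩
  · rw [Finset.mem_product, Finset.mem_Icc, Finset.mem_Icc]
    exact ⟨abs_le.1 h0, abs_le.1 h1⟩
  · unfold height at hx
    funext i
    fin_cases i
    · simp [planePoint]
    · simp [planePoint]
    · simp [planePoint]; omega

/-- The height of `x` determines its stick vertex, so membership becomes three bounds, visibly
monotone in `N`. -/
theorem mem_box_volume {N : ℕ} {x : Site} :
    x ∈ (box N).volume ↔ ∃ a : ℤ × ℤ, |a.1| ≤ N ∧ |a.2| ≤ N ∧ |height x| ≤ N ∧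
      planePoint a + stickPoint (height x) = x := by
  have hl : (((box N).len : ℕ) : ℤ) / 2 = N := by simp [box]
  rw [Cylinder.volume, Finset.mem_image₂, stick, hl]
  constructor
  · rintro ⟨γ, hγ, y, hy, rfl⟩
    obtain ⟨a, ha, rfl⟩ := Finset.mem_image.1 hγ
    obtain ⟨j, hj, rfl⟩ := Finset.mem_image.1 hy
    rw [Finset.mem_product, Finset.mem_Icc, Finset.mem_Icc] at ha
    have hh : height (planePoint a + stickPoint j) = j := by
      have := height_stickPoint j
      simp only [height, planePoint, Pi.add_apply] at this ⊢
      simp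
      omega
    rw [hh]
    exact ⟨a, abs_le.2 ha.1, abs_le.2 ha.2, abs_le.2 (Finset.mem_Icc.1 hj), rfl⟩
  · rintro ⟨a, h1, h2, h3, h4⟩
    refine ⟨planePoint a, Finset.mem_image_of_mem _ ?_, stickPoint (height x),
      Finset.mem_image_of_mem _ (Finset.mem_Icc.2 (abs_le.1 h3)), h4⟩
    rw [Finset.mem_product, Finset.mem_Icc, Finset.mem_Icc]
    exact ⟨abs_le.1 h1, abs_le.1 h2⟩

theorem box_volume_mono : Monotone fun N => (box N).volume := by
  intro N N' h x hx
  obtain ⟨a, h1, h2, h3, h4⟩ := mem_box_volume.1 hx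
  have : (N : ℤ) ≤ N' := by exact_mod_cast h
  exact mem_box_volume.2 ⟨a, h1.trans this, h2.trans this, h3.trans this, h4⟩

theorem exists_mem_box_volume (x : Site) : ∃ N, x ∈ (box N).volume := by
  set y := x - stickPoint (height x) with hy
  refine ⟨(y 0).natAbs + (y 1).natAbs + (height x).natAbs,
    mem_box_volume.2 ⟨(y 0, y 1), ?_, ?_, ?_, ?_⟩⟩
  · push_cast
    linarith [abs_nonneg (y 1), abs_nonneg (height x)]
  · push_cast
    linarith [abs_nonneg (y 0), abs_nonneg (height x)]
  · push_cast
    linarith [abs_nonneg (y 0), abs_nonneg (y 1)]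
  · have hp : planePoint (y 0, y 1) = y := by
      have h1 := height_stickPoint (height x)
      have h2 : height x = x 0 + x 1 + x 2 := rfl
      simp only [height] at h1
      have h3 : y 0 + y 1 + y 2 = 0 := by
        simp only [hy, Pi.sub_apply, height]
        omega
      funext i
      fin_cases i
      · simp [planePoint]
      · simp [planePoint]
      · simp [planePoint]; omega
    rw [hp, hy, sub_add_cancel]

theorem exhausts_box (K : ℕ) : Exhausts fun k => (box (k + K)).volume := by
  refine ⟨fun i j h => box_volume_mono (Nat.add_le_add_right h K), fun x => ?_⟩
  obtain ⟨N, hN⟩ := exists_mem_box_volume x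
  exact ⟨N, box_volume_mono (Nat.le_add_right N K) hN⟩

theorem len_box_le_diam (N : ℕ) :
    ((box N).len : ℝ) ≤ Metric.diam ((box N).base : Set Site) := by
  have h1 : (![(N : ℤ), 0, -N] : Site) ∈ (box N).base :=
    mem_box_base (by simp [height]) (by simp) (by simp)
  have h2 : (![-(N : ℤ), 0, N] : Site) ∈ (box N).base :=
    mem_box_base (by simp [height]) (by simp) (by simp)
  have h3 := Metric.dist_le_diam_of_mem (box N).base.finite_toSet.isBounded h1 h2
  refine le_trans ?_ ((dist_le_pi_dist _ _ 0).trans h3)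
  rw [Int.dist_eq]
  refine le_trans (le_of_eq ?_) (le_abs_self _)
  simp [box]
  ring

theorem len_box_le_sqrt_card (N : ℕ) : ((box N).len : ℝ) ≤ √((box N).base.card : ℝ) := by
  refine Real.le_sqrt_of_sq_le ?_
  have hc : (box N).base.card = (2 * N + 1) * (2 * N + 1) := by
    simp only [box]
    rw [Finset.card_image_of_injective _ planePoint_injective, Finset.card_product, Int.card_Icc]
    congr 1 <;> omega
  rw [hc]
  have : (0 : ℝ) ≤ N := Nat.cast_nonneg N
  simp only [box]
  push_cast
  nlinarith

/-! ### Tuning the chemical potential -/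

theorem occ_strictMono {q : ℝ} (hq0 : 0 < q) (hq1 : q < 1) (x : Site) :
    StrictMono fun μ => occ q μ x := by
  intro μ ν h
  have h1 : q ^ (2 * ((height x : ℝ) - μ)) < q ^ (2 * ((height x : ℝ) - ν)) :=
    Real.rpow_lt_rpow_of_exponent_gt hq0 hq1 (by linarith)
  have h2 : 1 - occ q ν x < 1 - occ q μ x := by
    rw [one_sub_occ hq0, one_sub_occ hq0]
    exact one_div_lt_one_div_of_lt (one_add_rpow_pos hq0 _) (by linarith)
  show occ q μ x < occ q ν x
  linarith

theorem mean_occ_mono {q : ℝ} (hq0 : 0 < q) (hq1 : q < 1) (s : Finset Site) :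
    Monotone fun μ => mean (occ q μ) s := fun _ _ h =>
  Finset.sum_le_sum fun x _ => (occ_strictMono hq0 hq1 x).monotone h

theorem continuous_mean_occ {q : ℝ} (hq : 0 < q) (s : Finset Site) :
    Continuous fun μ => mean (occ q μ) s :=
  continuous_finsetSum _ fun x _ => continuous_occ hq x

/-- Each site of height `0` gains the same `d > 0` and no site loses, so more than `1 / d` such
sites suffice. -/
theorem eventually_mean_add_one_le {q : ℝ} (hq0 : 0 < q) (hq1 : q < 1) {Λ : ℕ → Finset Site}
    (h : Exhausts Λ) {μ ν : ℝ} (hμν : μ < ν) :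
    ∀ᶠ k in atTop, mean (occ q μ) (Λ k) + 1 ≤ mean (occ q ν) (Λ k) := by
  set d := occ q ν 0 - occ q μ 0
  have hd : 0 < d := sub_pos.2 (occ_strictMono hq0 hq1 0 hμν)
  obtain ⟨N, hN⟩ := exists_nat_gt (1 / d)
  obtain ⟨T, hT, hTN⟩ := infinite_plane.exists_subset_card_eq N
  filter_upwards [eventually_subset h T] with k hk
  have h1 : ∑ x ∈ T, (occ q ν x - occ q μ x) ≤ ∑ x ∈ Λ k, (occ q ν x - occ q μ x) :=
    Finset.sum_le_sum_of_subset_of_nonneg hk fun x _ _ =>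
      sub_nonneg.2 ((occ_strictMono hq0 hq1 x).monotone hμν.le)
  have h2 : ∑ x ∈ T, (occ q ν x - occ q μ x) = N * d := by
    rw [← hTN, ← nsmul_eq_mul, ← Finset.sum_const]
    refine Finset.sum_congr rfl fun x hx => ?_
    have hx0 : height x = height 0 := (hT hx).trans (by simp [height])
    simp only [d, occ, hx0]
  have h3 : 1 < N * d := (div_lt_iff₀ hd).1 hN
  rw [h2, Finset.sum_sub_distrib] at h1
  simp only [mean]
  linarith

/-- Chemical potentials converging to `μ` at which the mean number of particles is an integer. -/
theorem exists_chemicalPotential {q : ℝ} (hq0 : 0 < q) (hq1 : q < 1) {Λ : ℕ → Finset Site}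
    (h : Exhausts Λ) (μ : ℝ)
    (h1 : ∀ k, mean (occ q μ) (Λ k) + 1 ≤ mean (occ q (μ + 1)) (Λ k)) :
    ∃ (n : ℕ → ℕ) (μs : ℕ → ℝ), (∀ k, grandCanonicalNumber q (Λ k) (μs k) = (n k : ℂ)) ∧
      Tendsto μs atTop (𝓝 μ) := by
  have hm0 : ∀ k, 0 ≤ mean (occ q μ) (Λ k) := fun k =>
    Finset.sum_nonneg fun x _ => (occ_pos hq0 μ x).le
  have hlt : ∀ k, (⌈mean (occ q μ) (Λ k)⌉₊ : ℝ) < mean (occ q μ) (Λ k) + 1 := fun k =>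
    Nat.ceil_lt_add_one (hm0 k)
  have hex : ∀ k, ∃ ν ∈ Set.Icc μ (μ + 1),
      mean (occ q ν) (Λ k) = ⌈mean (occ q μ) (Λ k)⌉₊ := fun k =>
    intermediate_value_Icc (by linarith) (continuous_mean_occ hq0 (Λ k)).continuousOn
      ⟨Nat.le_ceil _, (hlt k).le.trans (h1 k)⟩
  choose μs hμs hμs' using hex
  refine ⟨fun k => ⌈mean (occ q μ) (Λ k)⌉₊, μs, fun k => ?_, ?_⟩
  · rw [grandCanonicalNumber_eq hq0, hμs' k, Complex.ofReal_natCast]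
  · rw [Metric.tendsto_nhds]
    intro ε hε
    -- The chosen integer is less than one above the mean at `μ`, hence below the mean at `μ + ε`;
    -- monotonicity then traps `μs k`.
    filter_upwards [eventually_mean_add_one_le hq0 hq1 h (lt_add_of_pos_right μ hε)] with k hk
    have : μs k < μ + ε := by
      refine (mean_occ_mono hq0 hq1 (Λ k)).reflect_lt ?_
      simp only [hμs' k]
      exact (hlt k).trans_le hk
    rw [Real.dist_eq, abs_lt]
    constructor <;> linarith [(hμs k).1]

end XXZ

theorem mainTheorem8 (q : ℝ) (hq0 : 0 < q) (hq1 : q < 1) :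
    (∀ (C : ℕ → XXZ.Cylinder) (n : ℕ → ℕ) (μs : ℕ → ℝ) (μ : ℝ),
      XXZ.Exhausts (fun k => (C k).volume) →
      ((fun k => ((C k).len : ℝ)) =O[atTop]
        fun k => Metric.diam ((C k).base : Set XXZ.Site)) →
      (∀ k, XXZ.grandCanonicalNumber q (C k).volume (μs k) = (n k : ℂ)) →
      Tendsto μs atTop (𝓝 μ) →
      ∀ (Λ₀ : Finset XXZ.Site) (X : XXZ.Obs Λ₀), Commute X (XXZ.totalSpinZ Λ₀) →
        Tendsto (fun k => XXZ.canonicalAvg q (C k).volume (n k) X) atTop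
          (𝓝 (XXZ.grandCanonicalAvg q μ X))) ∧
    (∀ μ : ℝ, ∃ (C : ℕ → XXZ.Cylinder) (n : ℕ → ℕ) (μs : ℕ → ℝ),
      XXZ.Exhausts (fun k => (C k).volume) ∧
      ((fun k => ((C k).len : ℝ)) =O[atTop]
        fun k => Metric.diam ((C k).base : Set XXZ.Site)) ∧
      ((fun k => ((C k).len : ℝ)) =O[atTop] fun k => √((C k).base.card : ℝ)) ∧
      (∀ k, XXZ.grandCanonicalNumber q (C k).volume (μs k) = (n k : ℂ)) ∧
      Tendsto μs atTop (𝓝 μ) ∧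
      ∀ (Λ₀ : Finset XXZ.Site) (X : XXZ.Obs Λ₀), Commute X (XXZ.totalSpinZ Λ₀) →
        Tendsto (fun k => XXZ.canonicalAvg q (C k).volume (n k) X) atTop
          (𝓝 (XXZ.grandCanonicalAvg q μ X))) := by

  refine ⟨fun C n μs μ hC _ hn hμ Λ₀ X hX => XXZ.tendsto_canonicalAvg hq0 hC hn hμ hX,
    fun μ => ?_⟩
  -- Starting the boxes at `K` makes the gain of one particle between `μ` and `μ + 1` hold for every
  -- `k`.
  obtain ⟨K, hK⟩ := eventually_atTop.1
    (XXZ.eventually_mean_add_one_le hq0 hq1 (XXZ.exhausts_box 0) (lt_add_one μ))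
  obtain ⟨n, μs, hn, hμ⟩ := XXZ.exists_chemicalPotential hq0 hq1 (XXZ.exhausts_box K) μ
    fun k => hK (k + K) (Nat.le_add_left K k)
  refine ⟨fun k => XXZ.box (k + K), n, μs, XXZ.exhausts_box K, ?_, ?_, hn, hμ,
    fun Λ₀ X hX => XXZ.tendsto_canonicalAvg hq0 (XXZ.exhausts_box K) hn hμ hX⟩
  · refine IsBigO.of_bound 1 (Eventually.of_forall fun k => ?_)
    rw [one_mul, Real.norm_of_nonneg (Nat.cast_nonneg _), Real.norm_of_nonneg Metric.diam_nonneg]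
    exact XXZ.len_box_le_diam _
  · refine IsBigO.of_bound 1 (Eventually.of_forall fun k => ?_)
    rw [one_mul, Real.norm_of_nonneg (Nat.cast_nonneg _), Real.norm_of_nonneg (Real.sqrt_nonneg _)]
    exact XXZ.len_box_le_sqrt_card _
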